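/- For integers $n,k\ge 1$ let $\mathcal P_{n,k}$ be the set of all polynomials $P(x)=x^{n+1}R(x)$, where $R$ is a polynomial with real coefficients of degree at most $k-1$. Write $\|f\|_{[0,1]}:=\sup_{x\in[0,1]}|f(x)|$ and $V_0^1(f):=\int_0^1|f'(x)|\,dx$. There are absolute constants $c_1>0$ and $c_2>0$ such that, for all integers $n\ge 1$ and $k\ge 1$, both minima below are attained and $$c_1\frac nk\;\le\;\min_{0\ne P\in\mathcal P_{n,k}}\frac{\|P'\|_{[0,1]}}{V_0^1(P)}\;\le\;\min_{P\in\mathcal P_{n,k},\,P(1)\ne 0}\frac{\|P'\|_{[0,1]}}{|P(1)|}\;\le\;c_2\left(\frac nk+1\right).$$ Moreover, $c_1=1/12$ is a suitable choice. -/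

import Mathlib

namespace ReverseMarkov

/-- The polynomials `P(x) = x ^ (n + 1) * R(x)` where `R` is a real polynomial of degree at most
`k - 1` (i.e. of degree less than `k`; the zero polynomial is included). -/
def incompletePolynomials (n k : ℕ) : Set (Polynomial ℝ) :=
  {P | ∃ R ∈ Polynomial.degreeLT ℝ k, P = Polynomial.X ^ (n + 1) * R}

/-- The uniform norm `‖f‖_A`, the supremum of `|f x|` over `x ∈ A`. -/
noncomputable def supNorm (A : Set ℝ) (f : ℝ → ℝ) : ℝ :=
  sSup ((fun x => |f x|) '' A)

/-- The total variation `∫_a^b |f'(x)| dx` of a continuously differentiable function `f`. -/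
noncomputable def totalVariation (a b : ℝ) (f : ℝ → ℝ) : ℝ :=
  ∫ x in a..b, |deriv f x|

/-- The quotients `‖P'‖_{[0,1]} / V_0^1(P)`, over the `P` for which the denominator is not zero,
which are the nonzero `P`. -/
noncomputable def variationQuotients (n k : ℕ) : Set ℝ :=
  {r | ∃ P ∈ incompletePolynomials n k, P ≠ 0 ∧
    r = supNorm (Set.Icc 0 1) (deriv fun x => P.eval x) / totalVariation 0 1 fun x => P.eval x}

/-- The quotients `‖P'‖_{[0,1]} / |P(1)|`, over the `P` for which the denominator is not zero. -/
noncomputable def endpointQuotients (n k : ℕ) : Set ℝ :=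
  {r | ∃ P ∈ incompletePolynomials n k, P.eval 1 ≠ 0 ∧
    r = supNorm (Set.Icc 0 1) (deriv fun x => P.eval x) / |P.eval 1|}

end ReverseMarkov

open Polynomial Set

namespace ReverseMarkov

/-! ### Sup norm, total variation and nondegeneracy for polynomials. -/

section SupNorm

variable {g : ℝ → ℝ}

/-! Both minima exist by compactness, since the polynomials form a space of dimension `k`
(`exists_min_quotient`). They compare because `P(0) = 0` gives `|P(1)| ≤ V(P)`.

Lower bound: write `P' = x^n Q` with `deg Q ≤ k - 1`, `M = ‖P'‖`, `a = k/n`, `t = a s`. On `[1 - a,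
1]` the weight `x^n` is at least `e^(-2k)`, so `|Q| ≤ M e^(2k)` there. Chebyshev growth then gives
`|Q(1 - t)| ≤ M e^(2k) (4s)^(k-1)`, which loses to `(1 - t)^n ≤ e^(-ks)`: for `s ≥ 11` the product
is at most `M/s²` (`abs_pow_mul_eval_le`). So `|P'|` has mass at most `11aM + aM/11 ≤ 12aM`
(`integral_abs_pow_mul_eval_le`).

Upper bound: `bernsteinRamp` has value `k` at 1, and its derivative is `n + k` times a partial sum
of a partition of unity. The quotient is at most `(n + k)/k`, so `c₂ = 1`. -/

lemma abs_le_supNorm (hg : Continuous g) {x : ℝ} (hx : x ∈ Icc (0 : ℝ) 1) :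
    |g x| ≤ supNorm (Icc 0 1) g :=
  le_csSup (isCompact_Icc.image_of_continuousOn hg.abs.continuousOn).bddAbove
    (mem_image_of_mem _ hx)

lemma supNorm_le {M : ℝ} (h : ∀ x ∈ Icc (0 : ℝ) 1, |g x| ≤ M) : supNorm (Icc 0 1) g ≤ M := by
  refine csSup_le ((nonempty_Icc.2 zero_le_one).image _) ?_
  rintro _ ⟨x, hx, rfl⟩
  exact h x hx

lemma supNorm_const_mul (hg : Continuous g) (t : ℝ) :
    supNorm (Icc 0 1) (fun x => t * g x) = |t| * supNorm (Icc 0 1) g := by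
  have hle : ∀ (s : ℝ) {h : ℝ → ℝ}, Continuous h →
      supNorm (Icc 0 1) (fun x => s * h x) ≤ |s| * supNorm (Icc 0 1) h := fun s h hh =>
    supNorm_le fun x hx => by
      rw [abs_mul]
      exact mul_le_mul_of_nonneg_left (abs_le_supNorm hh hx) (abs_nonneg s)
  refine (hle t hg).antisymm ?_
  rcases eq_or_ne t 0 with rfl | ht
  · simpa using (abs_nonneg _).trans
      (abs_le_supNorm (g := fun _ => (0 : ℝ)) continuous_const (left_mem_Icc.2 zero_le_one))
  · have h := hle t⁻¹ (h := fun x => t * g x) (by fun_prop)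
    simp only [inv_mul_cancel_left₀ ht, abs_inv] at h
    rwa [le_inv_mul_iff₀ (abs_pos.2 ht)] at h

end SupNorm

lemma exists_eval_ne_zero {f : ℝ[X]} (hf : f ≠ 0) : ∃ x ∈ Icc (0 : ℝ) 1, f.eval x ≠ 0 := by
  by_contra! h
  exact hf (eq_zero_of_infinite_isRoot f ((Icc_infinite zero_lt_one).mono h))

lemma supNorm_eval_pos {f : ℝ[X]} (hf : f ≠ 0) : 0 < supNorm (Icc 0 1) (fun x => f.eval x) := by
  obtain ⟨x, hx, hfx⟩ := exists_eval_ne_zero hf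
  exact (abs_pos.2 hfx).trans_le (abs_le_supNorm (g := fun x => f.eval x) f.continuous hx)

lemma integral_abs_eval_pos {f : ℝ[X]} (hf : f ≠ 0) : 0 < ∫ x in (0 : ℝ)..1, |f.eval x| := by
  obtain ⟨x, hx, hfx⟩ := exists_eval_ne_zero hf
  exact intervalIntegral.integral_pos zero_lt_one f.continuous.abs.continuousOn
    (fun _ _ => abs_nonneg _) ⟨x, hx, abs_pos.2 hfx⟩

lemma deriv_eval (P : ℝ[X]) : (deriv fun x => P.eval x) = fun x => (derivative P).eval x :=
  funext fun _ => P.deriv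

lemma totalVariation_eval (P : ℝ[X]) :
    totalVariation 0 1 (fun x => P.eval x) = ∫ x in (0 : ℝ)..1, |(derivative P).eval x| := by
  rw [totalVariation, deriv_eval]

/-! ### Incomplete polynomials and their derivatives. -/

section IncompletePolynomials

variable {n k : ℕ} {P : ℝ[X]}

lemma eval_zero_of_mem (hP : P ∈ incompletePolynomials n k) : P.eval 0 = 0 := by
  obtain ⟨R, -, rfl⟩ := hP
  simp

lemma derivative_ne_zero_of_mem (hP : P ∈ incompletePolynomials n k) (h0 : P ≠ 0) :
    derivative P ≠ 0 := by
  intro h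
  have hC := eq_C_of_natDegree_eq_zero (derivative_eq_zero.1 h)
  refine h0 ?_
  rw [hC, coeff_zero_eq_eval_zero, eval_zero_of_mem hP, C_0]

lemma abs_eval_one_le_totalVariation (hP : P ∈ incompletePolynomials n k) :
    |P.eval 1| ≤ totalVariation 0 1 (fun x => P.eval x) := by
  have h : ∫ x in (0 : ℝ)..1, (derivative P).eval x = P.eval 1 - P.eval 0 :=
    intervalIntegral.integral_eq_sub_of_hasDerivAt (fun x _ => P.hasDerivAt x)
      ((derivative P).continuous.intervalIntegrable _ _)
  rw [eval_zero_of_mem hP, sub_zero] at h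
  rw [← h, totalVariation_eval]
  exact intervalIntegral.abs_integral_le_integral_abs zero_le_one

lemma exists_derivative_eq (hP : P ∈ incompletePolynomials n k) (hk : 1 ≤ k) :
    ∃ Q : ℝ[X], Q.degree ≤ (k - 1 : ℕ) ∧ derivative P = X ^ n * Q := by
  obtain ⟨R, hR, rfl⟩ := hP
  rw [mem_degreeLT] at hR
  have hR' : R.natDegree ≤ k - 1 := by
    rcases eq_or_ne R 0 with rfl | h0
    · simp
    · have := (natDegree_lt_iff_degree_lt h0).2 hR
      omega
  refine ⟨C ((n : ℝ) + 1) * R + X * derivative R, ?_, ?_⟩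
  · rw [← natDegree_le_iff_degree_le]
    refine natDegree_add_le_of_degree_le ((natDegree_C_mul_le _ _).trans hR') ?_
    rcases Nat.eq_zero_or_pos R.natDegree with h | h
    · rw [derivative_of_natDegree_zero h]
      simp
    · refine natDegree_mul_le.trans ?_
      have := natDegree_derivative_lt h.ne'
      rw [natDegree_X]
      omega
  · rw [derivative_mul, derivative_X_pow]
    push_cast
    simp only [map_add, map_natCast, C_1]
    ring

end IncompletePolynomials

/-! ### Existence of the minima. -/

section Minimum

/-- A quotient of absolutely homogeneous continuous functions on `ℝ ^ k` attains its minimum over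
the points where the denominator does not vanish. -/
lemma exists_min_quotient {k : ℕ} {N D : (Fin k → ℝ) → ℝ} (hN : Continuous N) (hD : Continuous D)
    (hNpos : ∀ c, c ≠ 0 → 0 < N c) (hDnonneg : ∀ c, 0 ≤ D c)
    (hNsmul : ∀ (t : ℝ) c, N (t • c) = |t| * N c) (hDsmul : ∀ (t : ℝ) c, D (t • c) = |t| * D c)
    (hne : ∃ c, D c ≠ 0) :
    ∃ c, D c ≠ 0 ∧ ∀ c', D c' ≠ 0 → N c / D c ≤ N c' / D c' := by
  have hD0 : ∀ c, D c ≠ 0 → c ≠ 0 := by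
    rintro c hc rfl
    exact hc (by simpa using hDsmul 0 0)
  have hunit : ∀ c : Fin k → ℝ, c ≠ 0 → ‖c‖⁻¹ • c ∈ Metric.sphere (0 : Fin k → ℝ) 1 := by
    intro c hc
    rw [mem_sphere_zero_iff_norm, norm_smul, norm_inv, norm_norm,
      inv_mul_cancel₀ (norm_ne_zero_iff.2 hc)]
  obtain ⟨c₁, hc₁⟩ := hne
  -- `D` may vanish on the sphere but `N` does not, so `D / N` is maximized instead.
  have hcont : ContinuousOn (fun c => D c / N c) (Metric.sphere (0 : Fin k → ℝ) 1) :=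
    hD.continuousOn.div hN.continuousOn fun c hc =>
      (hNpos c (ne_zero_of_mem_sphere one_ne_zero ⟨c, hc⟩)).ne'
  obtain ⟨c₀, hc₀, hmax⟩ := (isCompact_sphere (0 : Fin k → ℝ) 1).exists_isMaxOn
    ⟨_, hunit c₁ (hD0 c₁ hc₁)⟩ hcont
  have hle : ∀ c, c ≠ 0 → D c / N c ≤ D c₀ / N c₀ := by
    intro c hc
    have h := hmax (hunit c hc)
    simp only [mem_ofPred_eq, hDsmul, hNsmul] at h
    rwa [mul_div_mul_left _ _ (abs_ne_zero.2 (inv_ne_zero (norm_ne_zero_iff.2 hc)))] at h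
  have hpos : ∀ c, D c ≠ 0 → 0 < D c / N c := fun c hc =>
    div_pos ((hDnonneg c).lt_of_ne' hc) (hNpos c (hD0 c hc))
  have h₀ : 0 < D c₀ / N c₀ := (hpos c₁ hc₁).trans_le (hle c₁ (hD0 c₁ hc₁))
  refine ⟨c₀, fun h => by simp [h] at h₀, fun c hc => ?_⟩
  rw [← inv_div, ← inv_div (D c)]
  exact inv_anti₀ (hpos c hc) (hle c (hD0 c hc))

/-- The polynomial `x ^ (n + 1) * R(x)` where `R` has the given coefficients. -/
noncomputable def ofCoeffs (n k : ℕ) : (Fin k → ℝ) →ₗ[ℝ] ℝ[X] :=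
  LinearMap.mulLeft ℝ (X ^ (n + 1)) ∘ₗ (degreeLT ℝ k).subtype ∘ₗ
    (degreeLTEquiv ℝ k).symm.toLinearMap

variable {n k : ℕ}

lemma ofCoeffs_mem (c : Fin k → ℝ) : ofCoeffs n k c ∈ incompletePolynomials n k :=
  ⟨_, ((degreeLTEquiv ℝ k).symm c).2, rfl⟩

lemma exists_ofCoeffs_eq {P : ℝ[X]} (hP : P ∈ incompletePolynomials n k) :
    ∃ c, ofCoeffs n k c = P := by
  obtain ⟨R, hR, rfl⟩ := hP
  exact ⟨degreeLTEquiv ℝ k ⟨R, hR⟩, by simp [ofCoeffs]⟩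

lemma ofCoeffs_ne_zero {c : Fin k → ℝ} (hc : c ≠ 0) : ofCoeffs n k c ≠ 0 := by
  intro h
  refine hc ?_
  have h' : X ^ (n + 1) * (((degreeLTEquiv ℝ k).symm c : degreeLT ℝ k) : ℝ[X]) = 0 := h
  simpa using h'

/-- Joint continuity is what the parametric supremum and integral need; a general `Φ` covers both
`ofCoeffs` and its derivative. -/
lemma continuous_eval_linearMap (Φ : (Fin k → ℝ) →ₗ[ℝ] ℝ[X]) :
    Continuous fun p : (Fin k → ℝ) × ℝ => (Φ p.1).eval p.2 := by
  have h : ∀ p : (Fin k → ℝ) × ℝ, (Φ p.1).eval p.2 =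
      ∑ i, p.1 i * (Φ fun j => if i = j then 1 else 0).eval p.2 := fun p => by
    rw [Φ.pi_apply_eq_sum_univ, eval_finsetSum]
    simp
  simp only [h]
  refine continuous_finsetSum _ fun i _ => ?_
  exact ((continuous_apply i).comp continuous_fst).mul
    ((Polynomial.continuous _).comp continuous_snd)

/-- `‖P'‖_{[0,1]}` as a function of the coefficients of `P`. -/
noncomputable def coeffNorm (n k : ℕ) (c : Fin k → ℝ) : ℝ :=
  supNorm (Icc 0 1) (deriv fun x => (ofCoeffs n k c).eval x)

lemma continuous_derivative_ofCoeffs :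
    Continuous fun p : (Fin k → ℝ) × ℝ => (derivative (ofCoeffs n k p.1)).eval p.2 :=
  continuous_eval_linearMap (derivative ∘ₗ ofCoeffs n k)

lemma continuous_coeffNorm : Continuous (coeffNorm n k) := by
  have h := isCompact_Icc.continuous_sSup (K := Icc (0 : ℝ) 1)
    (f := fun (c : Fin k → ℝ) x => |(derivative (ofCoeffs n k c)).eval x|)
    continuous_derivative_ofCoeffs.abs
  convert h using 2 with c
  rw [coeffNorm, deriv_eval, supNorm]

lemma coeffNorm_pos (c : Fin k → ℝ) (hc : c ≠ 0) : 0 < coeffNorm n k c := by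
  rw [coeffNorm, deriv_eval]
  exact supNorm_eval_pos (derivative_ne_zero_of_mem (ofCoeffs_mem c) (ofCoeffs_ne_zero hc))

lemma coeffNorm_smul (t : ℝ) (c : Fin k → ℝ) :
    coeffNorm n k (t • c) = |t| * coeffNorm n k c := by
  rw [coeffNorm, coeffNorm, deriv_eval, deriv_eval]
  simp only [map_smul, eval_smul, smul_eq_mul]
  exact supNorm_const_mul (Polynomial.continuous _) t

lemma exists_isLeast_variationQuotients (hk : 1 ≤ k) :
    ∃ m, IsLeast (variationQuotients n k) m := by
  have hpos : ∀ c : Fin k → ℝ, c ≠ 0 →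
      0 < totalVariation 0 1 (fun x => (ofCoeffs n k c).eval x) := fun c hc => by
    rw [totalVariation_eval]
    exact integral_abs_eval_pos (derivative_ne_zero_of_mem (ofCoeffs_mem c) (ofCoeffs_ne_zero hc))
  obtain ⟨c, hc, hmin⟩ := exists_min_quotient (N := coeffNorm n k)
    (D := fun c => totalVariation 0 1 (fun x => (ofCoeffs n k c).eval x)) continuous_coeffNorm
    (by
      simp only [totalVariation_eval]
      exact intervalIntegral.continuous_parametric_intervalIntegral_of_continuous'
        (f := fun c x => |(derivative (ofCoeffs n k c)).eval x|)
        continuous_derivative_ofCoeffs.abs 0 1)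
    coeffNorm_pos
    (fun c => by
      rw [totalVariation_eval]
      exact intervalIntegral.integral_nonneg zero_le_one fun _ _ => abs_nonneg _)
    coeffNorm_smul
    (fun t c => by
      rw [totalVariation_eval, totalVariation_eval]
      simp [abs_mul])
    ⟨fun _ => 1, (hpos _ fun h => one_ne_zero (congrFun h ⟨0, hk⟩)).ne'⟩
  refine ⟨_, ⟨_, ofCoeffs_mem c, ?_, rfl⟩, ?_⟩
  · intro h
    exact hc (by simp [h, totalVariation])
  · rintro _ ⟨P, hP, hP0, rfl⟩
    obtain ⟨c', rfl⟩ := exists_ofCoeffs_eq hP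
    exact hmin c' (hpos c' fun h => hP0 (by rw [h, map_zero])).ne'

lemma exists_isLeast_endpointQuotients (hk : 1 ≤ k) :
    ∃ m, IsLeast (endpointQuotients n k) m := by
  have hX : (X ^ (n + 1) : ℝ[X]) ∈ incompletePolynomials n k :=
    ⟨1, by rw [mem_degreeLT, degree_one]; exact_mod_cast hk, by rw [mul_one]⟩
  obtain ⟨c₁, hc₁⟩ := exists_ofCoeffs_eq hX
  obtain ⟨c, hc, hmin⟩ := exists_min_quotient (N := coeffNorm n k)
    (D := fun c => |(ofCoeffs n k c).eval 1|) continuous_coeffNorm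
    ((continuous_eval_linearMap (ofCoeffs n k)).comp (Continuous.prodMk_left (1 : ℝ))).abs
    coeffNorm_pos (fun c => abs_nonneg _) coeffNorm_smul
    (fun t c => by simp [abs_mul]) ⟨c₁, by simp [hc₁]⟩
  refine ⟨_, ⟨_, ofCoeffs_mem c, abs_ne_zero.1 hc, rfl⟩, ?_⟩
  rintro _ ⟨P, hP, hP1, rfl⟩
  obtain ⟨c', rfl⟩ := exists_ofCoeffs_eq hP
  exact hmin c' (abs_ne_zero.2 hP1)

end Minimum

/-! ### Upper bound by a Bernstein sum. -/

section UpperBound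

/-- Summation by parts: the weights `j + 1` turn the differences in Bernstein derivatives into a
plain sum. -/
lemma sum_succ_mul_sub (b : ℕ → ℝ[X]) (m : ℕ) :
    ∑ j ∈ Finset.range m, ((j : ℝ[X]) + 1) * (b j - b (j + 1)) =
      ∑ j ∈ Finset.range m, b j - m * b m := by
  induction m with
  | zero => simp
  | succ m ih =>
    rw [Finset.sum_range_succ, ih, Finset.sum_range_succ]
    push_cast
    ring

/-- The Bernstein form of a multiple of the antiderivative of
`∑ i ∈ [n, n + k), (n + k - 1).choose i * x ^ i * (1 - x) ^ (n + k - 1 - i)`. -/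
noncomputable def bernsteinRamp (n k : ℕ) : ℝ[X] :=
  ∑ j ∈ Finset.range k, ((j : ℝ[X]) + 1) * bernsteinPolynomial ℝ (n + k) (n + j + 1)

lemma bernsteinRamp_mem (n k : ℕ) : bernsteinRamp n k ∈ incompletePolynomials n k := by
  refine ⟨∑ j ∈ Finset.range k, C (((j : ℝ) + 1) * ((n + k).choose (n + j + 1) : ℝ)) *
    (X ^ j * (1 - X) ^ (k - 1 - j)), ?_, ?_⟩
  · refine Submodule.sum_mem _ fun j hj => ?_
    have hj := Finset.mem_range.1 hj
    rw [mem_degreeLT]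
    rw [← smul_eq_C_mul]
    refine (degree_smul_le _ _).trans_lt ?_
    have h1 : (1 - X : ℝ[X]).natDegree ≤ 1 := by
      refine (natDegree_sub_le _ _).trans ?_
      simp
    have h2 : (X ^ j * (1 - X) ^ (k - 1 - j) : ℝ[X]).natDegree ≤ j + (k - 1 - j) * 1 :=
      natDegree_mul_le_of_le (natDegree_X_pow_le j) (natDegree_pow_le_of_le _ h1)
    exact (natDegree_le_iff_degree_le.1 h2).trans_lt (by exact_mod_cast (by omega))
  · rw [bernsteinRamp, Finset.mul_sum]
    refine Finset.sum_congr rfl fun j hj => ?_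
    have hj := Finset.mem_range.1 hj
    rw [bernsteinPolynomial, show n + k - (n + j + 1) = k - 1 - j by omega]
    simp only [map_mul, map_add, map_natCast, C_1]
    ring

lemma bernsteinRamp_eval_one (n k : ℕ) : (bernsteinRamp n k).eval 1 = k := by
  rcases k with _ | k
  · simp [bernsteinRamp]
  · rw [bernsteinRamp, Finset.sum_range_succ, eval_add, eval_finsetSum, Finset.sum_eq_zero]
    · simp [bernsteinPolynomial.eval_at_1, add_assoc]
    · intro j hj
      have hj := Finset.mem_range.1 hj
      rw [eval_mul, bernsteinPolynomial.eval_at_1, if_neg (by omega), mul_zero]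

lemma derivative_bernsteinRamp (n k : ℕ) :
    derivative (bernsteinRamp n (k + 1)) = ((n + k + 1 : ℕ) : ℝ[X]) *
      ∑ j ∈ Finset.range (k + 1), bernsteinPolynomial ℝ (n + k) (n + j) := by
  have h := sum_succ_mul_sub (fun j => bernsteinPolynomial ℝ (n + k) (n + j)) (k + 1)
  -- The boundary term has index above its degree.
  rw [bernsteinPolynomial.eq_zero_of_lt ℝ (show n + k < n + (k + 1) by omega), mul_zero,
    sub_zero] at h
  rw [← h, bernsteinRamp, derivative_sum, Finset.mul_sum]
  refine Finset.sum_congr rfl fun j _ => ?_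
  have hj : ((j : ℝ[X]) + 1) = ((j + 1 : ℕ) : ℝ[X]) := by push_cast; rfl
  rw [hj, derivative_natCast_mul, bernsteinPolynomial.derivative_succ]
  simp only [← add_assoc, Nat.add_sub_cancel]
  push_cast
  ring

lemma bernsteinPolynomial_eval_nonneg {x : ℝ} (hx : x ∈ Icc (0 : ℝ) 1) (N i : ℕ) :
    0 ≤ (bernsteinPolynomial ℝ N i).eval x := by
  have h0 := hx.1
  have h1 := sub_nonneg.2 hx.2
  simp only [bernsteinPolynomial, eval_mul, eval_pow, eval_sub, eval_one, eval_X, eval_natCast]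
  positivity

lemma supNorm_deriv_bernsteinRamp_le {n k : ℕ} (hk : 1 ≤ k) :
    supNorm (Icc 0 1) (deriv fun x => (bernsteinRamp n k).eval x) ≤ n + k := by
  obtain ⟨k, rfl⟩ := Nat.exists_eq_add_of_le' hk
  rw [deriv_eval]
  refine supNorm_le fun x hx => ?_
  have hnn := fun i => bernsteinPolynomial_eval_nonneg hx (n + k) i
  have hsum : ∑ i ∈ Finset.range (n + k + 1), (bernsteinPolynomial ℝ (n + k) i).eval x = 1 := by
    rw [← eval_finsetSum, bernsteinPolynomial.sum, eval_one]
  rw [add_assoc, Finset.sum_range_add] at hsum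
  have h0 := Finset.sum_nonneg fun i (_ : i ∈ Finset.range n) => hnn i
  have h1 := Finset.sum_nonneg fun i (_ : i ∈ Finset.range (k + 1)) => hnn (n + i)
  rw [derivative_bernsteinRamp, eval_mul, eval_natCast, eval_finsetSum,
    abs_of_nonneg (by positivity)]
  push_cast
  rw [← add_assoc]
  exact mul_le_of_le_one_right (by positivity) (by linarith)

end UpperBound

/-! ### Lower bound by Chebyshev growth against the decay of `x^n`. -/

section LowerBound

/-- With `x = cosh u`, `T_m(x) = cosh (m u) ≤ e^(m u)` and `e^u ≤ 2 cosh u`. -/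
lemma eval_T_le_two_mul_pow (m : ℕ) {x : ℝ} (hx : 1 ≤ x) :
    (Chebyshev.T ℝ m).eval x ≤ (2 * x) ^ m := by
  have h : (Chebyshev.T ℝ m).eval (Real.cosh (Real.arcosh x)) =
      Real.cosh ((m : ℤ) * Real.arcosh x) := Chebyshev.T_real_cosh _ _
  rw [Real.cosh_arcosh hx] at h
  have hu := Real.arcosh_nonneg hx
  have hexp : Real.exp (Real.arcosh x) ≤ 2 * x := by
    have := Real.cosh_eq (Real.arcosh x)
    rw [Real.cosh_arcosh hx] at this
    have := Real.exp_pos (-Real.arcosh x)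
    linarith
  calc (Chebyshev.T ℝ m).eval x = Real.cosh (m * Real.arcosh x) := by rw [h]; norm_cast
    _ ≤ Real.exp (m * Real.arcosh x) := by
      rw [Real.cosh_eq]
      have : Real.exp (-(m * Real.arcosh x)) ≤ Real.exp (m * Real.arcosh x) :=
        Real.exp_le_exp.2 (by nlinarith [mul_nonneg (Nat.cast_nonneg (α := ℝ) m) hu])
      linarith
    _ = Real.exp (Real.arcosh x) ^ m := by rw [← Real.exp_nat_mul]
    _ ≤ (2 * x) ^ m := by gcongr

lemma abs_eval_le_two_mul_pow {m : ℕ} {Q : ℝ[X]} {M x : ℝ} (hM : 0 < M) (hx : 1 ≤ x)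
    (hdeg : Q.degree ≤ m) (hQ : ∀ y ∈ Icc (-1 : ℝ) 1, |Q.eval y| ≤ M) :
    |Q.eval x| ≤ M * (2 * x) ^ m := by
  -- Chebyshev extremality is one-sided and normalized, so it is applied to both `Q/M` and `-Q/M`.
  have key : ∀ s : ℝ, |s| = M⁻¹ → s * Q.eval x ≤ (2 * x) ^ m := by
    intro s hs
    have h := Chebyshev.eval_iterate_derivative_le_of_forall_abs_le_one (n := m) (P := C s * Q)
      (k := 0) hx (by rw [← smul_eq_C_mul]; exact (degree_smul_le _ _).trans hdeg) (fun y hy => by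
        rw [eval_C_mul, abs_mul, hs, inv_mul_le_one₀ hM]
        exact hQ y hy)
    simp only [Function.iterate_zero, id_eq, eval_C_mul] at h
    exact h.trans (eval_T_le_two_mul_pow m hx)
  have h1 := key M⁻¹ (abs_of_pos (inv_pos.2 hM))
  have h2 := key (-M⁻¹) (by rw [abs_neg, abs_of_pos (inv_pos.2 hM)])
  rw [← inv_mul_le_iff₀ hM]
  rcases abs_cases (Q.eval x) with h | h <;> rw [h.1] <;> linarith

/-- Growth to the left of `[1 - a, 1]` of a polynomial of degree at most `m`. -/
lemma abs_eval_one_sub_le {m : ℕ} {Q : ℝ[X]} {M a t : ℝ} (hM : 0 < M) (ha : 0 < a) (ht : a ≤ t)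
    (hdeg : Q.degree ≤ m) (hQ : ∀ y ∈ Icc (1 - a) 1, |Q.eval y| ≤ M) :
    |Q.eval (1 - t)| ≤ M * (4 * (t / a)) ^ m := by
  -- The affine map of `[-1, 1]` onto `[1 - a, 1]` that reverses orientation.
  set L : ℝ[X] := C (1 - a / 2) - C (a / 2) * X with hL
  have hLdeg : L.natDegree ≤ 1 := by
    refine (natDegree_sub_le _ _).trans ?_
    simpa using natDegree_C_mul_le (a / 2) X
  have hta : 1 ≤ t / a := (one_le_div ha).2 ht
  have h := abs_eval_le_two_mul_pow (m := m) (Q := Q.comp L) (x := 2 * (t / a) - 1) hM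
    (by linarith)
    (by
      rw [← natDegree_le_iff_degree_le] at hdeg ⊢
      exact natDegree_comp_le.trans ((Nat.mul_le_mul hdeg hLdeg).trans_eq (mul_one m)))
    (fun y hy => by
      rw [eval_comp]
      refine hQ _ ?_
      simp only [hL, eval_sub, eval_mul, eval_C, eval_X]
      constructor <;> nlinarith [hy.1, hy.2])
  have hLx : L.eval (2 * (t / a) - 1) = 1 - t := by
    simp only [hL, eval_sub, eval_mul, eval_C, eval_X]
    field_simp
    ring
  rw [eval_comp, hLx] at h
  refine h.trans ?_
  have : (2 * (2 * (t / a) - 1)) ^ m ≤ (4 * (t / a)) ^ m :=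
    pow_le_pow_left₀ (by linarith) (by linarith) m
  gcongr

/-- At `s = 11` this is `4 · 11³ = 5324 ≤ e^9`; beyond, `s³ ≤ 11³ e^(s-11)`. -/
lemma four_mul_pow_three_mul_exp_le {s : ℝ} (hs : 11 ≤ s) :
    4 * s ^ 3 * Real.exp 2 ≤ Real.exp s := by
  have h9 : (5324 : ℝ) ≤ Real.exp 9 := by
    have h := pow_le_pow_left₀ (by norm_num) Real.exp_one_gt_d9.le 9
    rw [← Real.exp_nat_mul] at h
    norm_num at h
    linarith
  have h3 : s ^ 3 ≤ 1331 * Real.exp (s - 11) := by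
    have h := Real.add_one_le_exp ((s - 11) / 3)
    have h' := pow_le_pow_left₀ (by linarith) h 3
    rw [← Real.exp_nat_mul] at h'
    have he : ((3 : ℕ) : ℝ) * ((s - 11) / 3) = s - 11 := by push_cast; ring
    rw [he] at h'
    have : s ^ 3 ≤ 1331 * ((s - 11) / 3 + 1) ^ 3 := by
      have : s ^ 3 ≤ (11 * ((s - 11) / 3 + 1)) ^ 3 :=
        pow_le_pow_left₀ (by linarith) (by linarith) 3
      linarith
    linarith
  have hsplit : Real.exp s = Real.exp 9 * Real.exp (s - 11) * Real.exp 2 := by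
    rw [← Real.exp_add, ← Real.exp_add]
    ring_nf
  rw [hsplit]
  refine mul_le_mul_of_nonneg_right ?_ (Real.exp_pos 2).le
  nlinarith [Real.exp_pos (s - 11)]

lemma one_le_one_sub_mul_exp {a : ℝ} (ha0 : 0 ≤ a) (ha : a ≤ 1 / 2) :
    1 ≤ (1 - a) * Real.exp (2 * a) := by
  nlinarith [Real.add_one_le_exp (2 * a)]

/-- Decay to the left of `1 - 11 * k / n` of `x ^ n * Q(x)` with `Q` of degree less than `k`. -/
lemma abs_pow_mul_eval_le {n k : ℕ} (hk : 1 ≤ k) (hnk : 12 * k < n) {Q : ℝ[X]}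
    (hdeg : Q.degree ≤ (k - 1 : ℕ)) {M t : ℝ} (hM : 0 < M)
    (hQ : ∀ x ∈ Icc (0 : ℝ) 1, |x ^ n * Q.eval x| ≤ M)
    (ht : 11 * ((k : ℝ) / n) ≤ t) (ht1 : t ≤ 1) :
    |(1 - t) ^ n * Q.eval (1 - t)| ≤ M * ((k : ℝ) / n) ^ 2 * (t ^ 2)⁻¹ := by
  have hk0 : (0 : ℝ) < k := by exact_mod_cast hk
  have hnk' : 12 * (k : ℝ) < n := by exact_mod_cast hnk
  have hn0 : (0 : ℝ) < n := by linarith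
  set a : ℝ := (k : ℝ) / n with ha
  have ha0 : 0 < a := div_pos hk0 hn0
  have han : n * a = k := by rw [ha]; field_simp
  have ha2 : a ≤ 1 / 2 := by rw [ha, div_le_iff₀ hn0]; linarith
  have h1a : 0 < 1 - a := by linarith
  set s := t / a with hs
  have hs11 : 11 ≤ s := (le_div_iff₀ ha0).2 ht
  have hts : n * t = k * s := by rw [hs, ← han]; field_simp
  have hexp1 : 1 ≤ (1 - a) ^ n * Real.exp 2 ^ k := by
    have h := one_le_pow₀ (one_le_one_sub_mul_exp ha0.le ha2) (n := n)
    rw [mul_pow, ← Real.exp_nat_mul] at h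
    rw [← Real.exp_nat_mul]
    rwa [← han, show (n : ℝ) * a * 2 = n * (2 * a) by ring]
  have hQa : ∀ y ∈ Icc (1 - a) 1, |Q.eval y| ≤ M * Real.exp 2 ^ k := by
    intro y hy
    have hy0 : 0 < y := h1a.trans_le hy.1
    have h := hQ y ⟨hy0.le, hy.2⟩
    rw [abs_mul, abs_of_pos (pow_pos hy0 n)] at h
    have hpow : (1 - a) ^ n ≤ y ^ n := pow_le_pow_left₀ h1a.le hy.1 n
    have hE : 0 < Real.exp 2 ^ k := by positivity
    calc |Q.eval y| = 1 * |Q.eval y| := (one_mul _).symm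
      _ ≤ (y ^ n * Real.exp 2 ^ k) * |Q.eval y| := by
        gcongr
        exact hexp1.trans (by gcongr)
      _ = (y ^ n * |Q.eval y|) * Real.exp 2 ^ k := by ring
      _ ≤ M * Real.exp 2 ^ k := by gcongr
  have hgrow := abs_eval_one_sub_le (t := t) (by positivity) ha0 (by linarith) hdeg hQa
  rw [← hs] at hgrow
  have hdecay : (1 - t) ^ n ≤ Real.exp (-s) ^ k := by
    rw [← Real.exp_nat_mul, mul_neg, ← hts, ← mul_neg, Real.exp_nat_mul]
    exact pow_le_pow_left₀ (by linarith) (Real.one_sub_le_exp_neg t) n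
  have hbase : Real.exp (-s) * Real.exp 2 * (4 * s) ≤ (s ^ 2)⁻¹ := by
    rw [Real.exp_neg, mul_assoc, inv_mul_le_iff₀ (Real.exp_pos s), ← div_eq_mul_inv,
      le_div_iff₀ (by positivity)]
    linarith [four_mul_pow_three_mul_exp_le hs11]
  have hle1 : (s ^ 2)⁻¹ ≤ 1 := inv_le_one_of_one_le₀ (one_le_pow₀ (by linarith))
  calc |(1 - t) ^ n * Q.eval (1 - t)| = (1 - t) ^ n * |Q.eval (1 - t)| := by
        rw [abs_mul, abs_of_nonneg (pow_nonneg (by linarith) n)]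
    _ ≤ Real.exp (-s) ^ k * (M * Real.exp 2 ^ k * (4 * s) ^ (k - 1)) := by gcongr
    -- Raising the exponent to `k` (as `4s ≥ 1`) merges everything into one `k`-th power, with base
    -- at most `s⁻²` by `hbase`.
    _ ≤ Real.exp (-s) ^ k * (M * Real.exp 2 ^ k * (4 * s) ^ k) := by
      gcongr
      · linarith
      · omega
    _ = M * (Real.exp (-s) * Real.exp 2 * (4 * s)) ^ k := by
      rw [mul_pow, mul_pow]
      ring
    _ ≤ M * ((s ^ 2)⁻¹) ^ k := by gcongr
    _ ≤ M * (s ^ 2)⁻¹ := by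
      gcongr
      exact pow_le_of_le_one (by positivity) hle1 (by omega)
    _ = M * a ^ 2 * (t ^ 2)⁻¹ := by
      rw [hs, div_pow, inv_div]
      ring

lemma integral_inv_sq_le {b : ℝ} (hb : 0 < b) (hb1 : b ≤ 1) :
    ∫ t in b..1, (t ^ 2)⁻¹ ≤ b⁻¹ := by
  have hne : ∀ t ∈ uIcc b 1, t ≠ 0 := fun t ht => by
    rw [uIcc_of_le hb1] at ht
    exact (hb.trans_le ht.1).ne'
  have h : ∫ t in b..1, (t ^ 2)⁻¹ = -1⁻¹ - -b⁻¹ :=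
    intervalIntegral.integral_eq_sub_of_hasDerivAt
      (f := fun t : ℝ => -t⁻¹) (fun t ht => by
        simpa using (hasDerivAt_inv (hne t ht)).fun_neg)
      (ContinuousOn.intervalIntegrable (by
        refine ContinuousOn.inv₀ (by fun_prop) fun t ht => pow_ne_zero 2 (hne t ht)))
  rw [h]
  norm_num

lemma integral_abs_pow_mul_eval_le {n k : ℕ} (hn : 1 ≤ n) (hk : 1 ≤ k) {Q : ℝ[X]}
    (hdeg : Q.degree ≤ (k - 1 : ℕ)) {M : ℝ} (hM : 0 < M)
    (hQ : ∀ x ∈ Icc (0 : ℝ) 1, |x ^ n * Q.eval x| ≤ M) :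
    ∫ x in (0 : ℝ)..1, |x ^ n * Q.eval x| ≤ 12 * ((k : ℝ) / n) * M := by
  have hk0 : (0 : ℝ) < k := by exact_mod_cast hk
  have hn0 : (0 : ℝ) < n := by exact_mod_cast hn
  set f : ℝ → ℝ := fun x => |x ^ n * Q.eval x| with hf
  have hfc : Continuous f := (by fun_prop : Continuous fun x => x ^ n * Q.eval x).abs
  have hconst : ∀ (g : ℝ → ℝ) {u : ℝ}, 0 ≤ u → Continuous g → (∀ x ∈ Icc 0 u, g x ≤ M) →
      ∫ x in (0 : ℝ)..u, g x ≤ u * M := by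
    intro g u hu hg hgM
    have h := intervalIntegral.integral_mono_on hu (hg.intervalIntegrable 0 u)
      (continuous_const.intervalIntegrable (μ := MeasureTheory.volume) 0 u) hgM
    simpa using h
  -- For `n ≤ 12k` the trivial bound `M` suffices; otherwise `11a < 1` and the integral is split at
  -- distance `11a` from 1.
  rcases le_or_gt n (12 * k) with hnk | hnk
  · have hnk' : (n : ℝ) ≤ 12 * k := by exact_mod_cast hnk
    refine (hconst f zero_le_one hfc hQ).trans ?_
    gcongr
    rw [← mul_div_assoc, one_le_div hn0]
    exact hnk'
  · set a : ℝ := (k : ℝ) / n with ha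
    have ha0 : 0 < a := div_pos hk0 hn0
    have hb1 : 11 * a ≤ 1 := by
      have : 12 * (k : ℝ) < n := by exact_mod_cast hnk
      rw [ha, ← mul_div_assoc, div_le_one hn0]
      linarith
    have hb0 : 0 < 11 * a := by positivity
    set g : ℝ → ℝ := fun t => f (1 - t) with hg
    have hgc : Continuous g := hfc.comp (by fun_prop)
    have hfg : ∫ x in (0 : ℝ)..1, f x = ∫ t in (0 : ℝ)..1, g t := by
      simp [hg, intervalIntegral.integral_comp_sub_left f 1]
    have hnear := hconst g hb0.le hgc fun t ht =>
      hQ (1 - t) ⟨by linarith [ht.2], by linarith [ht.1]⟩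
    have hfar : ∫ t in (11 * a)..1, g t ≤ M * a ^ 2 * (11 * a)⁻¹ := by
      have h := intervalIntegral.integral_mono_on (μ := MeasureTheory.volume)
        (g := fun t => M * a ^ 2 * (t ^ 2)⁻¹) hb1 (hgc.intervalIntegrable _ _)
        (ContinuousOn.intervalIntegrable (by
          refine continuousOn_const.mul (ContinuousOn.inv₀ (by fun_prop) fun t ht => ?_)
          rw [uIcc_of_le hb1] at ht
          exact pow_ne_zero 2 (hb0.trans_le ht.1).ne'))
        (fun t ht => abs_pow_mul_eval_le hk hnk hdeg hM hQ ht.1 ht.2)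
      rw [intervalIntegral.integral_const_mul] at h
      exact h.trans (by gcongr; exact integral_inv_sq_le hb0 hb1)
    have hval : M * a ^ 2 * (11 * a)⁻¹ = a * M / 11 := by
      field_simp
    rw [hfg, ← intervalIntegral.integral_add_adjacent_intervals
      (hgc.intervalIntegrable 0 (11 * a)) (hgc.intervalIntegrable (11 * a) 1)]
    have : 0 < a * M := by positivity
    linarith

lemma le_variationQuotient {n k : ℕ} (hn : 1 ≤ n) (hk : 1 ≤ k) {r : ℝ}
    (hr : r ∈ variationQuotients n k) : 1 / 12 * ((n : ℝ) / k) ≤ r := by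
  obtain ⟨P, hP, hP0, rfl⟩ := hr
  have hP' := derivative_ne_zero_of_mem hP hP0
  have hM := supNorm_eval_pos hP'
  obtain ⟨Q, hdeg, hQ⟩ := exists_derivative_eq hP hk
  have hbd := integral_abs_pow_mul_eval_le hn hk hdeg hM fun x hx => by
    have h := abs_le_supNorm (g := fun x => (derivative P).eval x) (derivative P).continuous hx
    simpa [hQ] using h
  have hV := integral_abs_eval_pos hP'
  rw [totalVariation_eval, deriv_eval, le_div_iff₀ hV]
  have hVQ : ∫ x in (0 : ℝ)..1, |(derivative P).eval x| =
      ∫ x in (0 : ℝ)..1, |x ^ n * Q.eval x| := by simp [hQ]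
  have hk0 : (0 : ℝ) < k := by exact_mod_cast hk
  have hn0 : (0 : ℝ) < n := by exact_mod_cast hn
  rw [hVQ]
  calc 1 / 12 * ((n : ℝ) / k) * ∫ x in (0 : ℝ)..1, |x ^ n * Q.eval x|
      ≤ 1 / 12 * ((n : ℝ) / k) *
        (12 * ((k : ℝ) / n) * supNorm (Icc 0 1) fun x => (derivative P).eval x) := by gcongr
    _ = supNorm (Icc 0 1) fun x => (derivative P).eval x := by field_simp

end LowerBound

end ReverseMarkov

theorem theorem2p1 :
    ∃ c₁ c₂ : ℝ, 0 < c₁ ∧ 0 < c₂ ∧ c₁ = 1 / 12 ∧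
      ∀ n k : ℕ, 1 ≤ n → 1 ≤ k →
        ∃ m₁ m₂ : ℝ,
          IsLeast (ReverseMarkov.variationQuotients n k) m₁ ∧
          IsLeast (ReverseMarkov.endpointQuotients n k) m₂ ∧
          c₁ * ((n : ℝ) / k) ≤ m₁ ∧ m₁ ≤ m₂ ∧ m₂ ≤ c₂ * ((n : ℝ) / k + 1) := by
  refine ⟨1 / 12, 1, by norm_num, one_pos, rfl, fun n k hn hk => ?_⟩
  obtain ⟨m₁, hm₁⟩ := ReverseMarkov.exists_isLeast_variationQuotients (n := n) hk
  obtain ⟨m₂, hm₂⟩ := ReverseMarkov.exists_isLeast_endpointQuotients (n := n) hk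
  have hk0 : (0 : ℝ) < k := by exact_mod_cast hk
  refine ⟨m₁, m₂, hm₁, hm₂, ReverseMarkov.le_variationQuotient hn hk hm₁.1, ?_, ?_⟩
  · obtain ⟨P, hP, hP1, rfl⟩ := hm₂.1
    have hP0 : P ≠ 0 := fun h => hP1 (by simp [h])
    refine (hm₁.2 ⟨P, hP, hP0, rfl⟩).trans ?_
    have hM := ReverseMarkov.supNorm_eval_pos (ReverseMarkov.derivative_ne_zero_of_mem hP hP0)
    rw [← ReverseMarkov.deriv_eval] at hM
    exact div_le_div_of_nonneg_left hM.le (abs_pos.2 hP1)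
      (ReverseMarkov.abs_eval_one_le_totalVariation hP)
  · have h1 := ReverseMarkov.bernsteinRamp_eval_one n k
    refine (hm₂.2 ⟨_, ReverseMarkov.bernsteinRamp_mem n k, by rw [h1]; exact hk0.ne', rfl⟩).trans ?_
    rw [h1, abs_of_pos hk0, one_mul, div_add_one hk0.ne']
    gcongr
    exact ReverseMarkov.supNorm_deriv_bernsteinRamp_le hk
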